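/- Let $(\xi,X)$ be a random pair with values in $\mathbb{R}\times B$, where $B$ is a measurable space; $\xi$ and $X$ may be dependent. Let $\mathbf P$ be the law of $X$, and let $(\xi_i,X_i)_{i\le n}$ be i.i.d. copies of $(\xi,X)$. For a random variable $Y$ put $\|Y\|_{\psi_2}:=\inf\{c>0:\ \mathbb{E}[e^{(Y/c)^2}-1]\le 1\}\in[0,\infty]$, and for a measurable $f:B\to\mathbb{R}$ put $\|f\|_{\psi_2}:=\|f(X)\|_{\psi_2}$. Let $L_{\psi_2}$ be the set of measurable $f:B\to\mathbb R$ with $\|f\|_{\psi_2}<\infty$, and assume $\|\xi\|_{\psi_2}<\infty$. For $F\subset L_{\psi_2}$ let $\mathsf d(f,g):=\|f-g\|_{\psi_2}$, $\bar\Delta(F):=\sup_{f\in F}\|f\|_{\psi_2}$, and $$\gamma_2(F):=\inf_{(F_k)}\ \sup_{f\in F}\ \sum_{k\ge 0}2^{k/2}\,\mathsf d(f,F_k),\qquad \mathsf d(f,F_k):=\inf_{g\in F_k}\mathsf d(f,g),$$ where the infimum is over all sequences $(F_k)_{k\ge0}$ of subsets of $F$ with $|F_0|=1$, $|F_k|\le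 2^{2^k}$ for $k\ge1$, and $\bigcup_k F_k$ dense in $(F,\mathsf d)$ (these quantities may be $+\infty$, with $0\cdot\infty=0$). The multiplier process is $$M(f):=\frac1n\sum_{i=1}^n\bigl(\xi_i f(X_i)-\mathbb{E}[\xi f(X)]\bigr),\qquad f\in F.$$ Assume, as usual for suprema of processes, that $(M(f))_{f\in F}$ is separable: there is a countable $D\subset F$ such that almost surely, for all $f\in F$, $M(f)$ lies in the closure of $\{M(g):g\in D\}$ (automatic if $F$ is countable). There exist universal constants $c,C>0$ such that, in this setting, for all $f_0\in F$, $n\ge1$, $u\ge1$ and $v\ge1$, with probability at least $1-ce^{-u/4}-ce^{-nv}$, $$\sup_{f\in F}|M(f)-M(f_0)|\le C\left[\left(\sqrt v+1\right)\|\xi\|_{\psi_2}\frac{\gamma_2(F)}{\sqrt n}+\left(\sqrt{\frac{2u}{n}}+\frac un+\sqrt{\frac{uv}{n}}\right)\|\xi\|_{\psi_2}\,\bar\Delta(F)\right].$$ -/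

import Mathlib

open MeasureTheory ProbabilityTheory
open scoped ENNReal

noncomputable section

/-- The Orlicz function `ψ₂(t) = exp(t²) - 1`. -/
def psi2 (t : ℝ) : ℝ := Real.exp (t ^ 2) - 1

/-- The `ψ₂`-norm `inf {c > 0 : 𝔼[ψ₂(Y / c)] ≤ 1}` of a real function `Y` on a measure space,
with values in `[0, ∞]` (the infimum of the empty set being `∞`). -/
def psi2Norm {Ω : Type*} [MeasurableSpace Ω] (μ : Measure Ω) (Y : Ω → ℝ) : ℝ≥0∞ :=
  ⨅ (c : ℝ) (_ : 0 < c ∧ ∫⁻ ω, ENNReal.ofReal (psi2 (Y ω / c)) ∂μ ≤ 1), ENNReal.ofReal c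

/-- `L_{ψ₂}(P)`: the measurable functions with finite `ψ₂`-norm. -/
def LPsi2 {B : Type*} [MeasurableSpace B] (P : Measure B) : Set (B → ℝ) :=
  {f | Measurable f ∧ psi2Norm P f < ∞}

/-- The pseudo-distance `d(f, g) = ‖f - g‖_{ψ₂}`. -/
def psi2Dist {B : Type*} [MeasurableSpace B] (P : Measure B) (f g : B → ℝ) : ℝ≥0∞ :=
  psi2Norm P (fun x => f x - g x)

/-- `Δ̄(F) = sup_{f ∈ F} d(f, 0)`. -/
def psi2Radius {B : Type*} [MeasurableSpace B] (P : Measure B) (F : Set (B → ℝ)) : ℝ≥0∞ :=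
  ⨆ f ∈ F, psi2Dist P f (fun _ => 0)

/-- `d(t, A) = inf_{s ∈ A} d(t, s)`. -/
def distToSet {α : Type*} (d : α → α → ℝ≥0∞) (t : α) (A : Set α) : ℝ≥0∞ :=
  ⨅ s ∈ A, d t s

/-- Admissible sequences of subsets of `T` for the pseudo-distance `d`. -/
structure IsAdmissible {α : Type*} (d : α → α → ℝ≥0∞) (T : Set α) (A : ℕ → Set α) : Prop where
  subset : ∀ k, A k ⊆ T
  card_zero : (A 0).encard = 1
  card_le : ∀ k, 1 ≤ k → (A k).encard ≤ 2 ^ (2 ^ k)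
  dense : ∀ t ∈ T, ∀ ε : ℝ≥0∞, 0 < ε → ∃ s ∈ ⋃ k, A k, d t s < ε

/-- Talagrand's functional `γ₂(T, d) = inf_{(T_k)} sup_{t ∈ T} ∑_{k ≥ 0} 2^{k/2} d(t, T_k)`, the
infimum being over admissible sequences. -/
def gammaTwo {α : Type*} (d : α → α → ℝ≥0∞) (T : Set α) : ℝ≥0∞ :=
  ⨅ (A : ℕ → Set α) (_ : IsAdmissible d T A),
    ⨆ t ∈ T, ∑' k : ℕ, (2 : ℝ≥0∞) ^ ((k : ℝ) / 2) * distToSet d t (A k)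

/-- The multiplier process `M(f) = (1/n) ∑_{i ≤ n} (ξ_i f(X_i) - 𝔼[ξ f(X)])`, where `(ξ_i, X_i)` is
given by `ξs i`, `Xs i`. -/
def multProc {Ω B : Type*} [MeasurableSpace Ω] (μ : Measure Ω) (ξ : Ω → ℝ) (X : Ω → B)
    {n : ℕ} (ξs : Fin n → Ω → ℝ) (Xs : Fin n → Ω → B) (f : B → ℝ) (ω : Ω) : ℝ :=
  (1 / (n : ℝ)) * ∑ i : Fin n, (ξs i ω * f (Xs i ω) - ∫ ω', ξ ω' * f (X ω') ∂μ)

/-- Separability of a real process `(Z_t)_{t ∈ T}`: for some countable `D ⊆ T`, almost surely every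
value `Z_t`, `t ∈ T`, is a limit of values of the process along `D`. It holds trivially if `T` is
countable. -/
def IsSeparableFamily {Ω α : Type*} [MeasurableSpace Ω] (μ : Measure Ω) (Z : α → Ω → ℝ)
    (T : Set α) : Prop :=
  ∃ D : Set α, D ⊆ T ∧ D.Countable ∧
    ∀ᵐ ω ∂μ, ∀ t ∈ T, Z t ω ∈ closure ((fun s => Z s ω) '' D)

end

/-!
The proof is a generic chaining argument for the multiplier process `M`, in which sub-Gaussian
increments are available at all scales although `ξ f(X)` is only a `ψ₁`-variable.

For an increment `h = f - g`, Bernstein's inequality gives `|M h| ≲ ‖ξ‖ ‖h‖ (√(t / n) + t / n)` with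
probability at least `1 - 2 e⁻ᵗ` (`measure_multProc_gt_sqrt_add_le`), which is sub-Gaussian only for
`t ≤ n`. For `t > n`, the Cauchy–Schwarz inequality bounds `|∑ ξᵢ h(Xᵢ)|` by
`(∑ ξᵢ²)^{1/2} (∑ h(Xᵢ)²)^{1/2}`. Up to constants, the second sum is at most `‖h‖² (n + t)` with
probability at least `1 - e⁻ᵗ`, and the first, which does not depend on `h`, is at most `n v ‖ξ‖²`
outside a single event of probability `e^{-nv}` (`measure_compl_multiplierEvent_le`). Hence, on one
event, `|M h| ≲ √v ‖ξ‖ ‖h‖ √(t / n)` holds for all `t > 0`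
(`measure_multiplierEvent_inter_multProc_gt_le`).

With `t` proportional to `2ᵏ` at the level `k`, a union bound over the links of the chains yields
`√v ‖ξ‖ γ₂(F) / √n` (`measure_chain_le`). The chains start at a level `K` with `2ᴷ` between `u` and
`2u`: the links then fail with probability at most `2 e⁻ᵘ`, and the distance from the net of level
`K` to `f₀` is covered by Bernstein's inequality and one further union bound
(`measure_exists_increment_gt_le`), which gives the term in `Δ̄(F)`.

By separability the supremum may be taken along a sequence of functions. Adding the first `k` of them
to the net of level `k` makes every chain finite, so no convergence along the chain has to be
shown. An admissible sequence is chosen with value at most `γ₂(F) + Δ̄(F)`, the excess being absorbed by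
the term in `Δ̄(F)`.
-/

/-! ### The `ψ₂`-norm -/

section Psi2

variable {Ω : Type*} [MeasurableSpace Ω] {μ : Measure Ω}

/-- `HasPsi2Bound μ Y a` says that `a > 0` is an admissible constant in the definition of the
`ψ₂`-norm of `Y`, in the form `𝔼[exp ((Y / a)²)] ≤ 2` and with the integrability spelled out. -/
structure HasPsi2Bound (μ : Measure Ω) (Y : Ω → ℝ) (a : ℝ) : Prop where
  pos : 0 < a
  integrable : Integrable (fun ω => Real.exp ((Y ω / a) ^ 2)) μ
  integral_le : ∫ ω, Real.exp ((Y ω / a) ^ 2) ∂μ ≤ 2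

lemma psi2_nonneg (t : ℝ) : 0 ≤ psi2 t := by
  have := Real.one_le_exp (sq_nonneg t)
  unfold psi2; linarith

lemma exists_admissible_of_psi2Norm_lt {Y : Ω → ℝ} {r : ℝ≥0∞} (h : psi2Norm μ Y < r) :
    ∃ c : ℝ, 0 < c ∧ ∫⁻ ω, ENNReal.ofReal (psi2 (Y ω / c)) ∂μ ≤ 1 ∧ ENNReal.ofReal c < r := by
  simp only [psi2Norm, iInf_lt_iff] at h
  obtain ⟨c, ⟨h1, h2⟩, h3⟩ := h
  exact ⟨c, h1, h2, h3⟩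

lemma hasPsi2Bound_of_lt [IsProbabilityMeasure μ] {Y : Ω → ℝ} (hY : Measurable Y) {a : ℝ}
    (h : psi2Norm μ Y < ENNReal.ofReal a) : HasPsi2Bound μ Y a := by
  obtain ⟨c, hc, hint, hca⟩ := exists_admissible_of_psi2Norm_lt h
  have hca' : c < a := (ENNReal.ofReal_lt_ofReal_iff_of_nonneg hc.le).1 hca
  have ha : 0 < a := hc.trans hca'
  have hle : ∫⁻ ω, ENNReal.ofReal (Real.exp ((Y ω / a) ^ 2)) ∂μ ≤ ENNReal.ofReal 2 := by
    calc ∫⁻ ω, ENNReal.ofReal (Real.exp ((Y ω / a) ^ 2)) ∂μ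
        ≤ ∫⁻ ω, (ENNReal.ofReal (psi2 (Y ω / c)) + 1) ∂μ := by
          refine lintegral_mono fun ω => ?_
          rw [← ENNReal.ofReal_one, ← ENNReal.ofReal_add (psi2_nonneg _) zero_le_one]
          refine ENNReal.ofReal_le_ofReal ?_
          simp only [psi2, sub_add_cancel]
          refine Real.exp_le_exp.2 ?_
          rw [div_pow, div_pow]
          gcongr
      _ = ∫⁻ ω, ENNReal.ofReal (psi2 (Y ω / c)) ∂μ + 1 := by
          rw [lintegral_add_right _ measurable_const]; simp
      _ ≤ 1 + 1 := by gcongr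
      _ = ENNReal.ofReal 2 := by norm_num
  have hm : AEStronglyMeasurable (fun ω => Real.exp ((Y ω / a) ^ 2)) μ := by fun_prop
  refine ⟨ha, ⟨hm, ?_⟩, ?_⟩
  · rw [hasFiniteIntegral_iff_ofReal (ae_of_all _ fun ω => (Real.exp_pos _).le)]
    exact hle.trans_lt ENNReal.ofReal_lt_top
  · rw [integral_eq_lintegral_of_nonneg_ae (ae_of_all _ fun ω => (Real.exp_pos _).le) hm]
    exact ENNReal.toReal_le_of_le_ofReal (by norm_num) hle

lemma psi2Norm_neg (Y : Ω → ℝ) : psi2Norm μ (fun ω => -Y ω) = psi2Norm μ Y := by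
  simp [psi2Norm, psi2, neg_div]

lemma psi2_add_div_le {c d : ℝ} (hc : 0 < c) (hd : 0 < d) (y z : ℝ) :
    psi2 ((y + z) / (c + d)) ≤ c / (c + d) * psi2 (y / c) + d / (c + d) * psi2 (z / d) := by
  have hcd : c / (c + d) + d / (c + d) = 1 := by field_simp
  have hp : 0 ≤ c / (c + d) := by positivity
  have hq : 0 ≤ d / (c + d) := by positivity
  have e : (y + z) / (c + d) = c / (c + d) * (y / c) + d / (c + d) * (z / d) := by
    field_simp
  have h1 := (even_two.convexOn_pow (𝕜 := ℝ)).2 (Set.mem_univ (y / c)) (Set.mem_univ (z / d))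
    hp hq hcd
  have h2 := convexOn_exp.2 (Set.mem_univ ((y / c) ^ 2)) (Set.mem_univ ((z / d) ^ 2)) hp hq hcd
  simp only [smul_eq_mul] at h1 h2
  have h3 := (Real.exp_le_exp.2 h1).trans h2
  rw [← e] at h3
  unfold psi2
  nlinarith

lemma psi2Norm_add_le {Y Z : Ω → ℝ} (hY : Measurable Y) :
    psi2Norm μ (fun ω => Y ω + Z ω) ≤ psi2Norm μ Y + psi2Norm μ Z := by
  refine le_of_forall_gt fun r hr => ?_
  obtain ⟨r₁, hr₁, r₂, hr₂, hlt⟩ : ∃ r₁, psi2Norm μ Y < r₁ ∧ ∃ r₂, psi2Norm μ Z < r₂ ∧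
      r₁ + r₂ < r := by
    obtain ⟨r₁, h1, h2⟩ := exists_between (lt_tsub_iff_right.2 hr)
    obtain ⟨r₂, h3, h4⟩ := exists_between (lt_tsub_iff_left.2 (lt_tsub_iff_right.1 h2))
    exact ⟨r₁, h1, r₂, h3, lt_tsub_iff_left.1 h4⟩
  obtain ⟨c, hc, hcY, hc'⟩ := exists_admissible_of_psi2Norm_lt hr₁
  obtain ⟨d, hd, hdZ, hd'⟩ := exists_admissible_of_psi2Norm_lt hr₂
  have hp : 0 ≤ c / (c + d) := by positivity
  have hq : 0 ≤ d / (c + d) := by positivity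
  have key : ∫⁻ ω, ENNReal.ofReal (psi2 ((Y ω + Z ω) / (c + d))) ∂μ ≤ 1 := by
    calc ∫⁻ ω, ENNReal.ofReal (psi2 ((Y ω + Z ω) / (c + d))) ∂μ
        ≤ ∫⁻ ω, (ENNReal.ofReal (c / (c + d)) * ENNReal.ofReal (psi2 (Y ω / c)) +
            ENNReal.ofReal (d / (c + d)) * ENNReal.ofReal (psi2 (Z ω / d))) ∂μ := by
          refine lintegral_mono fun ω => ?_
          rw [← ENNReal.ofReal_mul hp, ← ENNReal.ofReal_mul hq,
            ← ENNReal.ofReal_add (mul_nonneg hp (psi2_nonneg _)) (mul_nonneg hq (psi2_nonneg _))]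
          exact ENNReal.ofReal_le_ofReal (psi2_add_div_le hc hd _ _)
      _ = ENNReal.ofReal (c / (c + d)) * ∫⁻ ω, ENNReal.ofReal (psi2 (Y ω / c)) ∂μ +
            ENNReal.ofReal (d / (c + d)) * ∫⁻ ω, ENNReal.ofReal (psi2 (Z ω / d)) ∂μ := by
          rw [lintegral_add_left, lintegral_const_mul' _ _ ENNReal.ofReal_ne_top,
            lintegral_const_mul' _ _ ENNReal.ofReal_ne_top]
          unfold psi2
          fun_prop
      _ ≤ ENNReal.ofReal (c / (c + d)) * 1 + ENNReal.ofReal (d / (c + d)) * 1 := by gcongr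
      _ = 1 := by
          rw [mul_one, mul_one, ← ENNReal.ofReal_add hp hq, ← ENNReal.ofReal_one]
          congr 1
          field_simp
  calc psi2Norm μ (fun ω => Y ω + Z ω) ≤ ENNReal.ofReal (c + d) :=
        iInf₂_le (c + d) ⟨by positivity, key⟩
    _ = ENNReal.ofReal c + ENNReal.ofReal d := ENNReal.ofReal_add hc.le hd.le
    _ ≤ r₁ + r₂ := add_le_add hc'.le hd'.le
    _ < r := hlt

lemma ae_eq_zero_of_psi2Norm_eq_zero {Y : Ω → ℝ} (hY : Measurable Y) (h : psi2Norm μ Y = 0) :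
    Y =ᵐ[μ] 0 := by
  have hsq : ∀ r : ℝ, 0 < r → ∫⁻ ω, ENNReal.ofReal ((Y ω) ^ 2) ∂μ ≤ ENNReal.ofReal (r ^ 2) := by
    intro r hr
    obtain ⟨c, hc, hint, hcr⟩ := exists_admissible_of_psi2Norm_lt
      (h.trans_lt (ENNReal.ofReal_pos.2 hr))
    have hcr' : c < r := (ENNReal.ofReal_lt_ofReal_iff hr).1 hcr
    calc ∫⁻ ω, ENNReal.ofReal ((Y ω) ^ 2) ∂μ
        ≤ ∫⁻ ω, ENNReal.ofReal (c ^ 2) * ENNReal.ofReal (psi2 (Y ω / c)) ∂μ := by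
          refine lintegral_mono fun ω => ?_
          rw [← ENNReal.ofReal_mul (by positivity)]
          refine ENNReal.ofReal_le_ofReal ?_
          have h1 := Real.add_one_le_exp ((Y ω / c) ^ 2)
          calc (Y ω) ^ 2 = c ^ 2 * (Y ω / c) ^ 2 := by field_simp
            _ ≤ c ^ 2 * psi2 (Y ω / c) := by unfold psi2; gcongr; linarith
      _ = ENNReal.ofReal (c ^ 2) * ∫⁻ ω, ENNReal.ofReal (psi2 (Y ω / c)) ∂μ :=
          lintegral_const_mul' _ _ ENNReal.ofReal_ne_top
      _ ≤ ENNReal.ofReal (r ^ 2) * 1 := by gcongr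
      _ = ENNReal.ofReal (r ^ 2) := mul_one _
  have hzero : ∫⁻ ω, ENNReal.ofReal ((Y ω) ^ 2) ∂μ = 0 := by
    refine le_antisymm (ENNReal.le_of_forall_pos_le_add fun ε hε _ => ?_) zero_le
    have := hsq (Real.sqrt ε) (Real.sqrt_pos.2 hε)
    rw [Real.sq_sqrt ε.coe_nonneg, ENNReal.ofReal_coe_nnreal] at this
    simpa using this
  rw [lintegral_eq_zero_iff (by fun_prop)] at hzero
  filter_upwards [hzero] with ω hω
  have h1 : (Y ω) ^ 2 ≤ 0 := by simpa using hω
  simpa using le_antisymm h1 (sq_nonneg _)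

/-- The product of two `ψ₂`-variables is a `ψ₁`-variable, whatever their joint law. -/
lemma HasPsi2Bound.exp_abs_mul {Y Z : Ω → ℝ} {a b : ℝ} (hY : HasPsi2Bound μ Y a)
    (hZ : HasPsi2Bound μ Z b) (hYm : Measurable Y) (hZm : Measurable Z) :
    Integrable (fun ω => Real.exp |Y ω * Z ω / (a * b)|) μ ∧
      ∫ ω, Real.exp |Y ω * Z ω / (a * b)| ∂μ ≤ 2 := by
  have hpt : ∀ ω, Real.exp |Y ω * Z ω / (a * b)| ≤
      (1 / 2 : ℝ) * (Real.exp ((Y ω / a) ^ 2) + Real.exp ((Z ω / b) ^ 2)) := by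
    intro ω
    have e : |Y ω * Z ω / (a * b)| = |Y ω / a| * |Z ω / b| := by
      rw [← abs_mul, div_mul_div_comm]
    have h1 : |Y ω * Z ω / (a * b)| ≤ (1 / 2 : ℝ) * (Y ω / a) ^ 2 + (1 / 2 : ℝ) * (Z ω / b) ^ 2 := by
      rw [e, ← sq_abs (Y ω / a), ← sq_abs (Z ω / b)]
      nlinarith [sq_nonneg (|Y ω / a| - |Z ω / b|)]
    have h2 := convexOn_exp.2 (Set.mem_univ ((Y ω / a) ^ 2)) (Set.mem_univ ((Z ω / b) ^ 2))
      (by norm_num : (0 : ℝ) ≤ 1 / 2) (by norm_num : (0 : ℝ) ≤ 1 / 2) (by norm_num)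
    simp only [smul_eq_mul] at h2
    have := (Real.exp_le_exp.2 h1).trans h2
    linarith
  have hI := (hY.integrable.add hZ.integrable).const_mul (1 / 2 : ℝ)
  have hI' : Integrable (fun ω => Real.exp |Y ω * Z ω / (a * b)|) μ := by
    refine hI.mono' (by fun_prop) (ae_of_all _ fun ω => ?_)
    rw [Real.norm_eq_abs, Real.abs_exp]
    exact hpt ω
  refine ⟨hI', (integral_mono hI' hI hpt).trans ?_⟩
  simp only [Pi.add_apply]
  rw [integral_const_mul, integral_add hY.integrable hZ.integrable]
  linarith [hY.integral_le, hZ.integral_le]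

end Psi2

/-! ### Exponential inequalities for i.i.d. samples -/

section Exponential

variable {Ω : Type*} [MeasurableSpace Ω] {μ : Measure Ω}

lemma exp_le_one_add_add_sq_mul_exp_abs (x : ℝ) :
    Real.exp x ≤ 1 + x + x ^ 2 * Real.exp |x| := by
  have h := Complex.norm_exp_sub_sum_le_norm_mul_exp (x : ℂ) 2
  have e : Complex.exp x - ∑ m ∈ Finset.range 2, (x : ℂ) ^ m / m.factorial
      = ((Real.exp x - (1 + x) : ℝ) : ℂ) := by
    simp [Finset.sum_range_succ]
  rw [e, Complex.norm_real, Complex.norm_real, Real.norm_eq_abs, Real.norm_eq_abs, sq_abs] at h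
  linarith [le_abs_self (Real.exp x - (1 + x))]

variable {W : Ω → ℝ}

lemma integrable_of_integrable_exp_abs (hW : Measurable W)
    (hI : Integrable (fun ω => Real.exp |W ω|) μ) : Integrable W μ :=
  hI.mono' hW.aestronglyMeasurable (ae_of_all _ fun ω => by
    rw [Real.norm_eq_abs]; linarith [Real.add_one_le_exp |W ω|])

variable [IsProbabilityMeasure μ]

lemma abs_integral_le_one_of_exp_abs (hW : Measurable W)
    (hI : Integrable (fun ω => Real.exp |W ω|) μ) (h2 : ∫ ω, Real.exp |W ω| ∂μ ≤ 2) :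
    |∫ ω, W ω ∂μ| ≤ 1 := by
  have hWi := integrable_of_integrable_exp_abs hW hI
  calc |∫ ω, W ω ∂μ| ≤ ∫ ω, |W ω| ∂μ := abs_integral_le_integral_abs
    _ ≤ ∫ ω, (Real.exp |W ω| - 1) ∂μ :=
        integral_mono hWi.abs (hI.sub (integrable_const 1)) fun ω => by
          simp only; linarith [Real.add_one_le_exp |W ω|]
    _ ≤ 1 := by
        rw [integral_sub hI (integrable_const 1)]
        simp only [integral_const, probReal_univ, smul_eq_mul]
        linarith

/-- A centred variable with `𝔼[exp |W|] ≤ 2` is sub-Gaussian near the origin. -/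
lemma integral_exp_mul_centered_le (hW : Measurable W)
    (hI : Integrable (fun ω => Real.exp |W ω|) μ) (h2 : ∫ ω, Real.exp |W ω| ∂μ ≤ 2)
    {s : ℝ} (hs : |s| ≤ 1 / 2) :
    Integrable (fun ω => Real.exp (s * (W ω - ∫ ω', W ω' ∂μ))) μ ∧
      ∫ ω, Real.exp (s * (W ω - ∫ ω', W ω' ∂μ)) ∂μ ≤ Real.exp (16 * s ^ 2) := by
  have hWi := integrable_of_integrable_exp_abs hW hI
  set m := ∫ ω', W ω' ∂μ
  have hpt : ∀ ω, Real.exp (s * W ω) ≤ 1 + s * W ω + 8 * s ^ 2 * Real.exp |W ω| := by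
    intro ω
    have h1 := exp_le_one_add_add_sq_mul_exp_abs (s * W ω)
    have h3 : |s * W ω| ≤ |W ω| / 2 := by
      rw [abs_mul]; nlinarith [abs_nonneg (W ω)]
    have h4 : (W ω) ^ 2 ≤ 8 * Real.exp (|W ω| / 2) := by
      have := Real.quadratic_le_exp_of_nonneg (x := |W ω| / 2) (by positivity)
      nlinarith [abs_nonneg (W ω), sq_abs (W ω)]
    have h5 : (s * W ω) ^ 2 * Real.exp |s * W ω| ≤ 8 * s ^ 2 * Real.exp |W ω| := by
      calc (s * W ω) ^ 2 * Real.exp |s * W ω|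
          ≤ (s ^ 2 * (8 * Real.exp (|W ω| / 2))) * Real.exp (|W ω| / 2) := by
            rw [mul_pow]; gcongr
        _ = 8 * s ^ 2 * (Real.exp (|W ω| / 2) * Real.exp (|W ω| / 2)) := by ring
        _ = 8 * s ^ 2 * Real.exp |W ω| := by rw [← Real.exp_add, add_halves]
    linarith
  have hB : Integrable (fun ω => 1 + s * W ω + 8 * s ^ 2 * Real.exp |W ω|) μ :=
    ((integrable_const 1).add (hWi.const_mul s)).add (hI.const_mul _)
  have hE : Integrable (fun ω => Real.exp (s * W ω)) μ :=
    hB.mono' (by fun_prop) (ae_of_all _ fun ω => by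
      rw [Real.norm_eq_abs, Real.abs_exp]; exact hpt ω)
  have hle : ∫ ω, Real.exp (s * W ω) ∂μ ≤ Real.exp (s * m + 16 * s ^ 2) := by
    calc ∫ ω, Real.exp (s * W ω) ∂μ
        ≤ ∫ ω, (1 + s * W ω + 8 * s ^ 2 * Real.exp |W ω|) ∂μ := integral_mono hE hB hpt
      _ = 1 + s * m + 8 * s ^ 2 * ∫ ω, Real.exp |W ω| ∂μ := by
          have h1 : Integrable (fun ω => 1 + s * W ω) μ :=
            (integrable_const 1).add (hWi.const_mul s)
          rw [integral_add h1 (hI.const_mul _), integral_add (integrable_const 1)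
            (hWi.const_mul s), integral_const_mul, integral_const_mul]
          simp [m]
      _ ≤ s * m + 16 * s ^ 2 + 1 := by nlinarith [sq_nonneg s]
      _ ≤ _ := Real.add_one_le_exp _
  have e : (fun ω => Real.exp (s * (W ω - m))) =
      fun ω => Real.exp (-(s * m)) * Real.exp (s * W ω) := by
    funext ω; rw [← Real.exp_add]; congr 1; ring
  rw [e]
  refine ⟨hE.const_mul _, ?_⟩
  rw [integral_const_mul]
  calc Real.exp (-(s * m)) * ∫ ω, Real.exp (s * W ω) ∂μ
      ≤ Real.exp (-(s * m)) * Real.exp (s * m + 16 * s ^ 2) := by gcongr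
    _ = Real.exp (16 * s ^ 2) := by rw [← Real.exp_add]; congr 1; ring

variable {E : Type*} [MeasurableSpace E] {n : ℕ} {Z : Ω → E} {S : Fin n → Ω → E}

/-- The Cramér–Chernoff bound for a sum over an i.i.d. sample. -/
lemma measure_sum_ge_le_of_integral_exp_le (hid : ∀ i, IdentDistrib (S i) Z μ μ)
    (hind : iIndepFun S μ) {φ : E → ℝ} (hφ : Measurable φ)
    (hI : Integrable (fun ω => Real.exp (φ (Z ω))) μ) {m : ℝ}
    (hm : ∫ ω, Real.exp (φ (Z ω)) ∂μ ≤ Real.exp m) (t : ℝ) :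
    μ {ω | n * m + t ≤ ∑ i, φ (S i ω)} ≤ ENNReal.ofReal (Real.exp (-t)) := by
  have hind' : iIndepFun (fun i ω => φ (S i ω)) μ := hind.comp (fun _ => φ) fun _ => hφ
  have hmeas : ∀ i, AEMeasurable (fun ω => φ (S i ω)) μ := fun i =>
    hφ.comp_aemeasurable (hid i).aemeasurable_fst
  have hmgf : mgf (∑ i, fun ω => φ (S i ω)) μ 1 = (∫ ω, Real.exp (φ (Z ω)) ∂μ) ^ n := by
    rw [hind'.mgf_sum₀ hmeas, Finset.prod_congr rfl (fun i _ => ?_), Finset.prod_const,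
      Finset.card_univ, Fintype.card_fin]
    simp only [mgf, one_mul]
    exact ((hid i).comp hφ.exp).integral_eq
  have hpos : 0 < ∫ ω, Real.exp (φ (Z ω)) ∂μ := integral_exp_pos hI
  -- The product formula also yields integrability, since a non-integrable function has integral `0`.
  have hint : Integrable (fun ω => Real.exp (1 * (∑ i, fun ω => φ (S i ω)) ω)) μ := by
    refine Integrable.of_integral_ne_zero ?_
    change mgf (∑ i, fun ω => φ (S i ω)) μ 1 ≠ 0
    rw [hmgf]
    positivity
  have h := measure_ge_le_exp_mul_mgf (n * m + t) zero_le_one hint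
  simp only [Finset.sum_apply] at h
  rw [← ENNReal.ofReal_toReal (measure_ne_top μ _)]
  refine ENNReal.ofReal_le_ofReal (h.trans ?_)
  rw [hmgf]
  calc Real.exp (-1 * (n * m + t)) * (∫ ω, Real.exp (φ (Z ω)) ∂μ) ^ n
      ≤ Real.exp (-1 * (n * m + t)) * Real.exp m ^ n := by gcongr
    _ = Real.exp (-t) := by rw [← Real.exp_nat_mul, ← Real.exp_add]; congr 1; ring

/-- Bernstein's inequality for an i.i.d. sample of a variable with `𝔼[exp |φ(Z)|] ≤ 2`, with the
Chernoff parameter `s` left free. -/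
lemma measure_abs_sum_sub_gt_le (hid : ∀ i, IdentDistrib (S i) Z μ μ)
    (hind : iIndepFun S μ) (hZ : Measurable Z) {φ : E → ℝ} (hφ : Measurable φ)
    (hI : Integrable (fun ω => Real.exp |φ (Z ω)|) μ) (h2 : ∫ ω, Real.exp |φ (Z ω)| ∂μ ≤ 2)
    {s t x : ℝ} (hs0 : 0 < s) (hs : s ≤ 1 / 2) (hx : n * (16 * s ^ 2) + t ≤ s * x) :
    μ {ω | x < |∑ i, (φ (S i ω) - ∫ ω', φ (Z ω') ∂μ)|} ≤ ENNReal.ofReal (2 * Real.exp (-t)) := by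
  set m := ∫ ω', φ (Z ω') ∂μ
  have hs' : |s| ≤ 1 / 2 := by rwa [abs_of_pos hs0]
  obtain ⟨hI₁, hle₁⟩ := integral_exp_mul_centered_le (hφ.comp hZ) hI h2 hs'
  obtain ⟨hI₂, hle₂⟩ := integral_exp_mul_centered_le (hφ.comp hZ) hI h2 (s := -s)
    (by rwa [abs_neg])
  rw [neg_sq] at hle₂
  have h₁ := measure_sum_ge_le_of_integral_exp_le hid hind
    (φ := fun e => s * (φ e - m)) (by fun_prop) hI₁ hle₁ t
  have h₂ := measure_sum_ge_le_of_integral_exp_le hid hind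
    (φ := fun e => -s * (φ e - m)) (by fun_prop) hI₂ hle₂ t
  have hsub : {ω | x < |∑ i, (φ (S i ω) - m)|} ⊆
      {ω | n * (16 * s ^ 2) + t ≤ ∑ i, s * (φ (S i ω) - m)} ∪
      {ω | n * (16 * s ^ 2) + t ≤ ∑ i, -s * (φ (S i ω) - m)} := by
    intro ω hω
    simp only [Set.mem_union, Set.mem_ofPred_eq, ← Finset.mul_sum] at hω ⊢
    rcases lt_abs.1 hω with h | h
    · left; nlinarith
    · right; nlinarith
  refine (measure_mono hsub).trans ((measure_union_le _ _).trans ?_)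
  rw [two_mul, ENNReal.ofReal_add (Real.exp_pos _).le (Real.exp_pos _).le]
  exact add_le_add h₁ h₂

end Exponential

/-! ### Increments of the multiplier process -/

section Increments

variable {Ω B : Type*} [MeasurableSpace Ω] [MeasurableSpace B] {μ : Measure Ω}

/-- The pairs `(ξs i, Xs i)` form an i.i.d. sample of the law of `(ξ, X)`. -/
structure IsIIDSample (μ : Measure Ω) (ξ : Ω → ℝ) (X : Ω → B) {n : ℕ} (ξs : Fin n → Ω → ℝ)
    (Xs : Fin n → Ω → B) : Prop where
  measurable_left : Measurable ξ
  measurable_right : Measurable X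
  identDistrib : ∀ i, IdentDistrib (fun ω => (ξs i ω, Xs i ω)) (fun ω => (ξ ω, X ω)) μ μ
  indep : iIndepFun (fun i ω => (ξs i ω, Xs i ω)) μ

variable {ξ : Ω → ℝ} {X : Ω → B} {n : ℕ} {ξs : Fin n → Ω → ℝ} {Xs : Fin n → Ω → B}

omit [MeasurableSpace B] in
lemma multProc_sub {f g : B → ℝ} (hf : Integrable (fun ω => ξ ω * f (X ω)) μ)
    (hg : Integrable (fun ω => ξ ω * g (X ω)) μ) (ω : Ω) :
    multProc μ ξ X ξs Xs f ω - multProc μ ξ X ξs Xs g ω =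
      multProc μ ξ X ξs Xs (fun x => f x - g x) ω := by
  have e : ∫ ω, ξ ω * (f (X ω) - g (X ω)) ∂μ =
      ∫ ω, ξ ω * f (X ω) ∂μ - ∫ ω, ξ ω * g (X ω) ∂μ := by
    rw [← integral_sub hf hg]; simp only [mul_sub]
  simp only [multProc, e]
  rw [← mul_sub, ← Finset.sum_sub_distrib]
  congr 1
  refine Finset.sum_congr rfl fun i _ => ?_
  ring

omit [MeasurableSpace B] in
lemma multProc_eq_mul_sum {a b : ℝ} (ha : 0 < a) (hb : 0 < b) (h : B → ℝ) (ω : Ω) :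
    multProc μ ξ X ξs Xs h ω = a * b / n *
      ∑ i, (ξs i ω * h (Xs i ω) / (a * b) - ∫ ω', ξ ω' * h (X ω') / (a * b) ∂μ) := by
  simp only [multProc, integral_div, ← sub_div, ← Finset.sum_div]
  field_simp

lemma multProc_ae_eq_zero (hS : IsIIDSample μ ξ X ξs Xs) {h : B → ℝ} (hh : Measurable h)
    (h0 : ∀ᵐ ω ∂μ, h (X ω) = 0) : ∀ᵐ ω ∂μ, multProc μ ξ X ξs Xs h ω = 0 := by
  have hi : ∀ i, ∀ᵐ ω ∂μ, h (Xs i ω) = 0 := fun i =>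
    (hS.identDistrib i).symm.ae_snd (p := fun e => h e.2 = 0)
      (measurableSet_eq_fun (by fun_prop) measurable_const) h0
  have hz : ∫ ω, ξ ω * h (X ω) ∂μ = 0 :=
    integral_eq_zero_of_ae (by filter_upwards [h0] with ω hω; simp [hω])
  filter_upwards [ae_all_iff.2 hi] with ω hω
  simp [multProc, hω, hz]

/-- If `ξ = 0` almost surely, then the whole process vanishes outside a single null set. -/
lemma multProc_ae_eq_zero_of_left (hS : IsIIDSample μ ξ X ξs Xs) (h0 : ∀ᵐ ω ∂μ, ξ ω = 0) :
    ∀ᵐ ω ∂μ, ∀ f, multProc μ ξ X ξs Xs f ω = 0 := by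
  have hi : ∀ i, ∀ᵐ ω ∂μ, ξs i ω = 0 := fun i =>
    (hS.identDistrib i).symm.ae_snd (p := fun e => e.1 = 0)
      (measurableSet_eq_fun (by fun_prop) measurable_const) h0
  have hz : ∀ f : B → ℝ, ∫ ω, ξ ω * f (X ω) ∂μ = 0 := fun f =>
    integral_eq_zero_of_ae (by filter_upwards [h0] with ω hω; simp [hω])
  filter_upwards [ae_all_iff.2 hi] with ω hω f
  simp [multProc, hω, hz]

/-- The event that the empirical second moment of the multipliers is at most `2 v a²`. -/
def multiplierEvent (ξs : Fin n → Ω → ℝ) (a v : ℝ) : Set Ω :=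
  {ω | ∑ i, (ξs i ω / a) ^ 2 ≤ 2 * n * v}

variable [IsProbabilityMeasure μ]

lemma exp_one_ge_two : (2 : ℝ) ≤ Real.exp 1 := by linarith [Real.add_one_le_exp (1 : ℝ)]

lemma measure_compl_multiplierEvent_le (hS : IsIIDSample μ ξ X ξs Xs) {a v : ℝ}
    (hξ : HasPsi2Bound μ ξ a) (hv : 1 ≤ v) :
    μ (multiplierEvent ξs a v)ᶜ ≤ ENNReal.ofReal (Real.exp (-(n * v))) := by
  refine (measure_mono ?_).trans (measure_sum_ge_le_of_integral_exp_le hS.identDistrib hS.indep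
    (φ := fun e => (e.1 / a) ^ 2) (by fun_prop) hξ.integrable
    (hξ.integral_le.trans exp_one_ge_two) (n * v))
  intro ω hω
  have h1 : 2 * n * v < ∑ i, (ξs i ω / a) ^ 2 := not_le.1 hω
  have h2 : (n : ℝ) ≤ n * v := le_mul_of_one_le_right (Nat.cast_nonneg n) hv
  change n * 1 + n * v ≤ ∑ i, (ξs i ω / a) ^ 2
  linarith

/-- Bernstein's inequality for the multiplier process with a free Chernoff parameter `s`. -/
lemma measure_multProc_gt_le (hS : IsIIDSample μ ξ X ξs Xs) (hn : 1 ≤ n) {h : B → ℝ}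
    (hh : Measurable h) {a b : ℝ} (hξ : HasPsi2Bound μ ξ a)
    (hb : HasPsi2Bound μ (fun ω => h (X ω)) b) {s t r : ℝ} (hs0 : 0 < s) (hs : s ≤ 1 / 2)
    (hr : 16 * s ^ 2 + t / n ≤ s * r) :
    μ {ω | r * (a * b) < |multProc μ ξ X ξs Xs h ω|} ≤ ENNReal.ofReal (2 * Real.exp (-t)) := by
  have hn0 : (0 : ℝ) < n := by exact_mod_cast hn
  have hab : 0 < a * b := mul_pos hξ.pos hb.pos
  obtain ⟨hI, h2⟩ := hξ.exp_abs_mul hb hS.measurable_left (hh.comp hS.measurable_right)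
  have hx : n * (16 * s ^ 2) + t ≤ s * (n * r) := by
    have := mul_le_mul_of_nonneg_left hr hn0.le
    rw [mul_add, mul_div_cancel₀ _ hn0.ne'] at this
    linarith
  have hm := hS.measurable_left
  have hm' := hS.measurable_right
  refine (measure_mono ?_).trans (measure_abs_sum_sub_gt_le hS.identDistrib hS.indep
    (by fun_prop) (φ := fun e => e.1 * h e.2 / (a * b)) (by fun_prop) hI h2 hs0 hs hx)
  intro ω hω
  change n * r < |∑ i, (ξs i ω * h (Xs i ω) / (a * b) - ∫ ω', ξ ω' * h (X ω') / (a * b) ∂μ)|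
  change r * (a * b) < |multProc μ ξ X ξs Xs h ω| at hω
  rw [multProc_eq_mul_sum hξ.pos hb.pos, abs_mul, abs_of_pos (by positivity)] at hω
  rw [← mul_lt_mul_iff_right₀ (show 0 < a * b / n by positivity)]
  refine lt_of_eq_of_lt ?_ hω
  field_simp

/-- Bernstein's inequality for the multiplier process, obtained with `s = √(t / n) / 2` if `t ≤ n` and
`s = 1 / 2` otherwise. -/
lemma measure_multProc_gt_sqrt_add_le (hS : IsIIDSample μ ξ X ξs Xs) (hn : 1 ≤ n) {h : B → ℝ}
    (hh : Measurable h) {a b : ℝ} (hξ : HasPsi2Bound μ ξ a)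
    (hb : HasPsi2Bound μ (fun ω => h (X ω)) b) {t : ℝ} (ht : 0 < t) :
    μ {ω | 10 * (Real.sqrt (t / n) + t / n) * (a * b) < |multProc μ ξ X ξs Xs h ω|} ≤
      ENNReal.ofReal (2 * Real.exp (-t)) := by
  have hn0 : (0 : ℝ) < n := by exact_mod_cast hn
  have hq : 0 < t / n := by positivity
  have hsq : 0 < Real.sqrt (t / n) := Real.sqrt_pos.2 hq
  have hsq2 := Real.sq_sqrt hq.le
  rcases le_total (t / n) 1 with h1 | h1
  · refine measure_multProc_gt_le hS hn hh hξ hb (s := Real.sqrt (t / n) / 2) (by positivity) ?_ ?_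
    · linarith [Real.sqrt_le_one.2 h1]
    · nlinarith [mul_pos hsq hq]
  · refine measure_multProc_gt_le hS hn hh hξ hb (s := 1 / 2) (by norm_num) le_rfl ?_
    linarith

/-- On the event that the multipliers have a bounded empirical second moment, the increments are
sub-Gaussian at all scales: for `t ≤ n` by Bernstein's inequality, and for `t > n` by the
Cauchy–Schwarz inequality and the exponential moments of `∑ h(X_i)²`. -/
lemma measure_multiplierEvent_inter_multProc_gt_le (hS : IsIIDSample μ ξ X ξs Xs) (hn : 1 ≤ n)
    {h : B → ℝ} (hh : Measurable h) {a b : ℝ} (hξ : HasPsi2Bound μ ξ a)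
    (hb : HasPsi2Bound μ (fun ω => h (X ω)) b) {t v : ℝ} (ht : 0 < t) (hv : 1 ≤ v) :
    μ (multiplierEvent ξs a v ∩ {ω | 10 * (Real.sqrt v * Real.sqrt (t / n)) * (a * b) <
      |multProc μ ξ X ξs Xs h ω|}) ≤ ENNReal.ofReal (2 * Real.exp (-t)) := by
  have hn0 : (0 : ℝ) < n := by exact_mod_cast hn
  have hq : 0 < t / n := by positivity
  have hsq : 0 < Real.sqrt (t / n) := Real.sqrt_pos.2 hq
  have hsq2 := Real.sq_sqrt hq.le
  have hv1 : 1 ≤ Real.sqrt v := Real.one_le_sqrt.2 hv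
  have ha := hξ.pos
  have hb0 := hb.pos
  rcases le_total (t / n) 1 with h1 | h1
  · refine (measure_mono Set.inter_subset_right).trans (measure_multProc_gt_le hS hn hh hξ hb
      (s := Real.sqrt (t / n) / 2) (by positivity) (by linarith [Real.sqrt_le_one.2 h1]) ?_)
    nlinarith [mul_le_mul_of_nonneg_right hv1 hq.le]
  · have htn : (n : ℝ) ≤ t := (one_le_div hn0).1 h1
    have hs1 : 1 ≤ Real.sqrt (t / n) := Real.one_le_sqrt.2 h1
    obtain ⟨hI, h2⟩ := hξ.exp_abs_mul hb hS.measurable_left (hh.comp hS.measurable_right)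
    have hm := hS.measurable_left
    have hm' := hS.measurable_right
    have hmean := abs_integral_le_one_of_exp_abs
      (W := fun ω => ξ ω * h (X ω) / (a * b)) (by fun_prop) hI h2
    have hcard := measure_sum_ge_le_of_integral_exp_le hS.identDistrib hS.indep
      (φ := fun e => (h e.2 / b) ^ 2) (by fun_prop) hb.integrable
      (hb.integral_le.trans exp_one_ge_two) t
    refine (measure_mono ?_).trans (hcard.trans (ENNReal.ofReal_le_ofReal ?_))
    swap
    · linarith [Real.exp_pos (-t)]
    rintro ω ⟨hω₁, hω₂⟩
    rw [Set.mem_ofPred_eq] at hω₂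
    change ∑ i, (ξs i ω / a) ^ 2 ≤ 2 * n * v at hω₁
    change n * 1 + t ≤ ∑ i, (h (Xs i ω) / b) ^ 2
    by_contra! hlt
    have hH : ∑ i, (h (Xs i ω) / b) ^ 2 ≤ 2 * t := by linarith
    refine (lt_irrefl _ (hω₂.trans_le ?_)).elim
    set m := ∫ ω', ξ ω' * h (X ω') / (a * b) ∂μ with hm_def
    have hcs : |∑ i, ξs i ω * h (Xs i ω) / (a * b)| ≤ 2 * n * (Real.sqrt v * Real.sqrt (t / n)) := by
      refine abs_le_of_sq_le_sq ?_ (by positivity)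
      have h3 := Finset.sum_mul_sq_le_sq_mul_sq Finset.univ (fun i => ξs i ω / a)
        (fun i => h (Xs i ω) / b)
      have h4 : (∑ i, (ξs i ω / a) ^ 2) * ∑ i, (h (Xs i ω) / b) ^ 2 ≤ (2 * n * v) * (2 * t) :=
        mul_le_mul hω₁ hH (Finset.sum_nonneg fun i _ => sq_nonneg _) (by positivity)
      have h5 : (2 * n * (Real.sqrt v * Real.sqrt (t / n))) ^ 2 = (2 * n * v) * (2 * t) := by
        rw [mul_pow, mul_pow (Real.sqrt v), Real.sq_sqrt (by linarith), hsq2]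
        field_simp
      rw [h5]
      simp only [div_mul_div_comm] at h3
      exact h3.trans h4
    have hall : |∑ i, (ξs i ω * h (Xs i ω) / (a * b) - m)| ≤
        n * (10 * (Real.sqrt v * Real.sqrt (t / n))) := by
      rw [Finset.sum_sub_distrib, Finset.sum_const, Finset.card_univ, Fintype.card_fin,
        nsmul_eq_mul]
      have h6 : |(n : ℝ) * m| ≤ n * (Real.sqrt v * Real.sqrt (t / n)) := by
        rw [abs_mul, abs_of_pos hn0]
        gcongr
        exact hmean.trans (one_le_mul_of_one_le_of_one_le hv1 hs1)
      have h7 := abs_sub (∑ i, ξs i ω * h (Xs i ω) / (a * b)) (n * m)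
      have h8 : 0 ≤ n * (Real.sqrt v * Real.sqrt (t / n)) := by positivity
      linarith
    rw [multProc_eq_mul_sum ha hb0, abs_mul, abs_of_pos (by positivity)]
    calc a * b / n * |∑ i, (ξs i ω * h (Xs i ω) / (a * b) - m)|
        ≤ a * b / n * (n * (10 * (Real.sqrt v * Real.sqrt (t / n)))) := by gcongr
      _ = 10 * (Real.sqrt v * Real.sqrt (t / n)) * (a * b) := by field_simp

variable {P : Measure B}

omit [IsProbabilityMeasure μ] in
lemma psi2Norm_comp (hX : Measurable X) (hP : μ.map X = P) {h : B → ℝ} (hh : Measurable h) :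
    psi2Norm μ (fun ω => h (X ω)) = psi2Norm P h := by
  unfold psi2Norm
  congr! 6 with c
  rw [← hP, lintegral_map _ hX]
  unfold psi2
  fun_prop

lemma psi2Dist_comm (f g : B → ℝ) : psi2Dist P f g = psi2Dist P g f := by
  unfold psi2Dist
  rw [← psi2Norm_neg]
  simp

lemma psi2Dist_self (f : B → ℝ) : psi2Dist P f f = 0 := by
  refine le_antisymm (ENNReal.le_of_forall_pos_le_add fun ε hε _ => ?_) zero_le
  refine (iInf₂_le (ε : ℝ) ⟨hε, ?_⟩).trans (by simp)
  simp [psi2]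

lemma psi2Dist_triangle {f g h : B → ℝ} (hf : Measurable f) (hg : Measurable g) :
    psi2Dist P f h ≤ psi2Dist P f g + psi2Dist P g h := by
  unfold psi2Dist
  refine le_of_eq_of_le ?_ (psi2Norm_add_le (hf.sub hg))
  congr 1
  funext x
  simp

lemma psi2Dist_lt_top {f g : B → ℝ} (hf : f ∈ LPsi2 P) (hg : g ∈ LPsi2 P) :
    psi2Dist P f g < ∞ := by
  have h := psi2Norm_add_le (μ := P) (Y := f) (Z := fun x => -g x) hf.1
  rw [psi2Norm_neg] at h
  exact (le_of_eq_of_le (by simp [psi2Dist, sub_eq_add_neg]) h).trans_lt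
    (ENNReal.add_lt_top.2 ⟨hf.2, hg.2⟩)

lemma integrable_mul_of_mem_LPsi2 (hS : IsIIDSample μ ξ X ξs Xs) (hP : μ.map X = P) {a : ℝ}
    (hξ : HasPsi2Bound μ ξ a) {f : B → ℝ} (hf : f ∈ LPsi2 P) :
    Integrable (fun ω => ξ ω * f (X ω)) μ := by
  have hm := hS.measurable_left
  have hm' := hS.measurable_right
  have hf1 := hf.1
  obtain ⟨b, hfb⟩ : ∃ b : ℝ, HasPsi2Bound μ (fun ω => f (X ω)) b := by
    obtain ⟨q, h1, h2⟩ := ENNReal.lt_iff_exists_nnreal_btwn.1 hf.2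
    refine ⟨q, hasPsi2Bound_of_lt (by fun_prop) ?_⟩
    rw [psi2Norm_comp hm' hP hf1]
    simpa using h1
  obtain ⟨hI, h2⟩ := hξ.exp_abs_mul hfb hm (hf1.comp hm')
  have := (integrable_of_integrable_exp_abs (W := fun ω => ξ ω * f (X ω) / (a * b))
    (by fun_prop) hI).mul_const (a * b)
  have hab := (mul_pos hξ.pos hfb.pos).ne'
  simpa [div_mul_cancel₀ _ hab] using this

/-- Passage from a tail bound valid for all `ψ₂`-constants of `f - g` to one in terms of
`d(f, g)`. The constants `2 ‖ξ‖` and `2 d(f, g)` are used since they are strictly larger than the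
norms, unless `d(f, g) = 0`, in which case the increment vanishes almost surely. -/
lemma measure_increment_le_of_forall (hS : IsIIDSample μ ξ X ξs Xs) (hP : μ.map X = P)
    (hξ : HasPsi2Bound μ ξ (2 * (psi2Norm μ ξ).toReal)) (hξ' : psi2Norm μ ξ < ∞) {f g : B → ℝ}
    (hf : f ∈ LPsi2 P) (hg : g ∈ LPsi2 P) (V : Set Ω) {r : ℝ} (hr : 0 ≤ r) {q : ℝ≥0∞}
    (H : ∀ b, HasPsi2Bound μ (fun ω => f (X ω) - g (X ω)) b →
      μ (V ∩ {ω | r * (2 * (psi2Norm μ ξ).toReal * b) <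
        |multProc μ ξ X ξs Xs (fun x => f x - g x) ω|}) ≤ q) :
    μ (V ∩ {ω | ¬ ENNReal.ofReal |multProc μ ξ X ξs Xs f ω - multProc μ ξ X ξs Xs g ω| ≤
      ENNReal.ofReal (4 * r) * psi2Norm μ ξ * psi2Dist P f g}) ≤ q := by
  have hfg : Measurable (fun x => f x - g x) := hf.1.sub hg.1
  have hcomp := psi2Norm_comp hS.measurable_right hP hfg
  have hfi := integrable_mul_of_mem_LPsi2 hS hP hξ hf
  have hgi := integrable_mul_of_mem_LPsi2 hS hP hξ hg
  simp only [multProc_sub hfi hgi]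
  have hm : Measurable (fun ω => f (X ω) - g (X ω)) := hfg.comp hS.measurable_right
  by_cases hd : psi2Dist P f g = 0
  · have h0 := ae_eq_zero_of_psi2Norm_eq_zero hm (hcomp.trans hd)
    have h1 := multProc_ae_eq_zero hS hfg h0
    refine le_of_eq_of_le (measure_mono_null Set.inter_subset_right ?_) zero_le
    rw [← ae_iff]
    filter_upwards [h1] with ω hω
    simp [hω]
  · have hdt := psi2Dist_lt_top hf hg
    set δ := (psi2Dist P f g).toReal with hδ_def
    have hδ : psi2Dist P f g = ENNReal.ofReal δ := (ENNReal.ofReal_toReal hdt.ne).symm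
    have hα : psi2Norm μ ξ = ENNReal.ofReal (psi2Norm μ ξ).toReal :=
      (ENNReal.ofReal_toReal hξ'.ne).symm
    have hδ0 : 0 < δ := ENNReal.toReal_pos hd hdt.ne
    have hb : HasPsi2Bound μ (fun ω => f (X ω) - g (X ω)) (2 * δ) := by
      refine hasPsi2Bound_of_lt hm (hcomp.trans_lt ?_)
      change psi2Dist P f g < _
      rw [hδ]
      exact (ENNReal.ofReal_lt_ofReal_iff (by positivity)).2 (by linarith)
    refine (measure_mono (Set.inter_subset_inter_right _ ?_)).trans (H _ hb)
    intro ω hω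
    by_contra hlt
    refine hω ?_
    have hle : |multProc μ ξ X ξs Xs (fun x => f x - g x) ω| ≤
      r * (2 * (psi2Norm μ ξ).toReal * (2 * δ)) := not_lt.1 hlt
    rw [hδ, hα, ← ENNReal.ofReal_mul (by positivity), ← ENNReal.ofReal_mul (by positivity)]
    exact ENNReal.ofReal_le_ofReal (hle.trans_eq (by ring))

end Increments

/-! ### Generic chaining -/

section Chaining

variable {α : Type*}

/-- Finite nets realising the value of an admissible sequence up to the slack `δ`. If `δ = 0`, a
slack is not available, but then the one-point nets are exact. -/
lemma exists_finset_nets {d : α → α → ℝ≥0∞} {T : Set α} {t₀ : α} (ht₀ : t₀ ∈ T) {δ : ℝ≥0∞}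
    (hδ : δ = 0 → ∀ t ∈ T, d t t₀ = 0) (hγ : gammaTwo d T < ∞) :
    ∃ (A : ℕ → Finset α) (π : ℕ → α → α), (∀ k, ↑(A k) ⊆ T) ∧ (∀ k, (A k).card ≤ 2 ^ 2 ^ k) ∧
      ∀ t ∈ T, (∀ k, π k t ∈ A k) ∧
        ∑' k : ℕ, (2 : ℝ≥0∞) ^ ((k : ℝ) / 2) * d t (π k t) ≤ gammaTwo d T + δ := by
  rcases eq_or_ne δ 0 with h0 | h0
  · refine ⟨fun _ => {t₀}, fun _ _ => t₀, by simpa using ht₀, fun k => ?_, fun t ht => ⟨by simp, ?_⟩⟩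
    · simpa using Nat.one_le_two_pow
    · simp [hδ h0 t ht]
  · have hlt : gammaTwo d T < gammaTwo d T + δ := ENNReal.lt_add_right hγ.ne h0
    nth_rewrite 1 [gammaTwo] at hlt
    simp only [iInf_lt_iff] at hlt
    obtain ⟨A, hA, hlt⟩ := hlt
    have hcard : ∀ k, (A k).encard ≤ ((2 ^ 2 ^ k : ℕ) : ℕ∞) := by
      intro k
      rcases Nat.eq_zero_or_pos k with rfl | hk
      · rw [hA.card_zero]; norm_num
      · exact_mod_cast hA.card_le k hk
    have hfin : ∀ k, (A k).Finite := fun k =>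
      Set.finite_of_encard_le_coe (hcard k)
    have hne : ∀ k, (A k).Nonempty := by
      intro k
      by_contra hk
      rw [Set.not_nonempty_iff_eq_empty] at hk
      have h1 : ∑' k : ℕ, (2 : ℝ≥0∞) ^ ((k : ℝ) / 2) * distToSet d t₀ (A k) < ∞ :=
        (le_iSup₂ (f := fun t (_ : t ∈ T) =>
          ∑' k : ℕ, (2 : ℝ≥0∞) ^ ((k : ℝ) / 2) * distToSet d t (A k)) t₀ ht₀).trans_lt
          (hlt.trans_le le_top)
      refine (ENNReal.ne_top_of_tsum_ne_top h1.ne k) ?_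
      have h2 : (2 : ℝ≥0∞) ^ ((k : ℝ) / 2) ≠ 0 := (ENNReal.rpow_pos (by norm_num) (by norm_num)).ne'
      simp [distToSet, hk, ENNReal.mul_top h2]
    choose π hπ hmin using fun k t => Set.exists_min_image (A k) (fun s => d t s) (hfin k) (hne k)
    refine ⟨fun k => (hfin k).toFinset, π, fun k => by simpa using hA.subset k, fun k => ?_,
      fun t ht => ⟨fun k => by simpa using hπ k t, ?_⟩⟩
    · have := hcard k
      rw [(hfin k).encard_eq_coe_toFinset_card] at this
      exact_mod_cast this
    · refine le_trans ?_ hlt.le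
      refine le_trans (ENNReal.tsum_le_tsum fun k => ?_) (le_iSup₂ (f := fun t (_ : t ∈ T) =>
        ∑' k : ℕ, (2 : ℝ≥0∞) ^ ((k : ℝ) / 2) * distToSet d t (A k)) t ht)
      gcongr
      exact le_iInf₂ fun s hs => hmin k t s hs

open Classical in
/-- The net `A k`, enlarged by the first `k` points of an enumeration `e` of the index set. Every
point of the enumeration belongs to all but finitely many of these nets, so that all chains are
finite. -/
noncomputable def enumNet (A : ℕ → Finset α) (e : ℕ → α) (k : ℕ) : Finset α :=
  A k ∪ (Finset.range k).image e

lemma card_enumNet_le {A : ℕ → Finset α} (hA : ∀ k, (A k).card ≤ 2 ^ 2 ^ k) (e : ℕ → α) (k : ℕ) :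
    ((enumNet A e k).card : ℝ) ≤ Real.exp (2 * 2 ^ k) := by
  classical
  have h1 : (enumNet A e k).card ≤ 2 ^ 2 ^ k + k := by
    refine (Finset.card_union_le _ _).trans (add_le_add (hA k) ?_)
    exact Finset.card_image_le.trans (Finset.card_range k).le
  have h2 : k ≤ 2 ^ 2 ^ k := (Nat.lt_two_pow_self.trans Nat.lt_two_pow_self).le
  have h3 : 2 ≤ 2 ^ 2 ^ k := by
    calc 2 = 2 ^ 1 := rfl
      _ ≤ 2 ^ 2 ^ k := Nat.pow_le_pow_right (by norm_num) Nat.one_le_two_pow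
  have h4 : (enumNet A e k).card ≤ 2 ^ (2 * 2 ^ k) := by
    rw [two_mul, pow_add]; nlinarith
  have h5 : (2 : ℝ) ≤ Real.exp 1 := exp_one_ge_two
  calc ((enumNet A e k).card : ℝ) ≤ (2 : ℝ) ^ (2 * 2 ^ k) := by exact_mod_cast h4
    _ ≤ Real.exp 1 ^ (2 * 2 ^ k) := by gcongr
    _ = Real.exp (2 * 2 ^ k) := by rw [← Real.exp_nat_mul]; push_cast; congr 1; ring

lemma tsum_exp_neg_two_pow_le :
    ∑' k : ℕ, ENNReal.ofReal (Real.exp (-2 ^ k)) ≤ 1 := by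
  calc ∑' k : ℕ, ENNReal.ofReal (Real.exp (-2 ^ k)) ≤ ∑' k : ℕ, (2⁻¹ : ℝ≥0∞) ^ (k + 1) := by
        refine ENNReal.tsum_le_tsum fun k => ?_
        have h1 : Real.exp (-2 ^ k) ≤ (2⁻¹ : ℝ) ^ (k + 1) := by
          have h2 : ((k + 1 : ℕ) : ℝ) ≤ 2 ^ k := by exact_mod_cast Nat.lt_two_pow_self
          have h3 : Real.exp (-1) ≤ 2⁻¹ := by
            rw [Real.exp_neg]; exact inv_anti₀ (by norm_num) exp_one_ge_two
          calc Real.exp (-2 ^ k) ≤ Real.exp ((k + 1 : ℕ) * (-1)) := by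
                refine Real.exp_le_exp.2 ?_
                linarith
            _ = Real.exp (-1) ^ (k + 1) := Real.exp_nat_mul _ _
            _ ≤ (2⁻¹ : ℝ) ^ (k + 1) := by gcongr
        refine (ENNReal.ofReal_le_ofReal h1).trans_eq ?_
        rw [ENNReal.ofReal_pow (by norm_num), ENNReal.ofReal_inv_of_pos (by norm_num)]
        norm_num
    _ = 1 := by
        rw [ENNReal.tsum_geometric_add_one, ENNReal.one_sub_inv_two, inv_inv,
          ENNReal.inv_mul_cancel (by norm_num) (by norm_num)]

lemma ofReal_abs_sub_le_sum_Ico (x : ℕ → ℝ) {K N : ℕ} (h : K ≤ N) :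
    ENNReal.ofReal |x N - x K| ≤ ∑ k ∈ Finset.Ico K N, ENNReal.ofReal |x (k + 1) - x k| := by
  rw [← Finset.sum_Ico_sub x h, ← ENNReal.ofReal_sum_of_nonneg fun _ _ => abs_nonneg _]
  exact ENNReal.ofReal_le_ofReal (Finset.abs_sum_le_sum_abs _ _)

lemma ofReal_sqrt_eight_mul_two_pow_le (k : ℕ) :
    ENNReal.ofReal (Real.sqrt (8 * 2 ^ k)) ≤ 3 * (2 : ℝ≥0∞) ^ ((k : ℝ) / 2) := by
  have h1 : Real.sqrt (8 * 2 ^ k) ≤ 3 * (2 : ℝ) ^ ((k : ℝ) / 2) := by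
    refine Real.sqrt_le_iff.2 ⟨by positivity, ?_⟩
    rw [mul_pow, ← Real.rpow_natCast ((2 : ℝ) ^ ((k : ℝ) / 2)), ← Real.rpow_mul (by norm_num)]
    have : (k : ℝ) / 2 * (2 : ℕ) = k := by push_cast; ring
    rw [this, Real.rpow_natCast]
    nlinarith [pow_pos (two_pos : (0 : ℝ) < 2) k]
  refine (ENNReal.ofReal_le_ofReal h1).trans_eq ?_
  rw [ENNReal.ofReal_mul (by norm_num), ← ENNReal.ofReal_rpow_of_pos (by norm_num)]
  norm_num

/-- The deterministic part of the generic chaining: the path `ρ` is at every level at least as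
close to `t` as the chain `p` is, and it has arrived at `t` at the level `N`. -/
lemma ofReal_abs_sub_le_of_chain {d : α → α → ℝ≥0∞} {z : α → ℝ} {ρ : ℕ → α} {t : α}
    {σ Γ : ℝ≥0∞} {p : ℕ → α} {K N : ℕ} (hKN : K ≤ N) (hN : ρ N = t)
    (hd : ∀ k, d (ρ (k + 1)) (ρ k) ≤ d t (ρ (k + 1)) + d t (ρ k))
    (hρ : ∀ k, d t (ρ k) ≤ d t (p k))
    (hΓ : ∑' k : ℕ, (2 : ℝ≥0∞) ^ ((k : ℝ) / 2) * d t (p k) ≤ Γ)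
    (hz : ∀ k, K ≤ k → ENNReal.ofReal |z (ρ (k + 1)) - z (ρ k)| ≤
      ENNReal.ofReal (Real.sqrt (8 * 2 ^ k)) * σ * d (ρ (k + 1)) (ρ k)) :
    ENNReal.ofReal |z t - z (ρ K)| ≤ 6 * σ * Γ := by
  set b : ℕ → ℝ≥0∞ := fun k => (2 : ℝ≥0∞) ^ ((k : ℝ) / 2) * d t (p k) with hb
  have hstep : ∀ k, K ≤ k → ENNReal.ofReal |z (ρ (k + 1)) - z (ρ k)| ≤
      3 * σ * (b (k + 1) + b k) := by
    intro k hk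
    calc ENNReal.ofReal |z (ρ (k + 1)) - z (ρ k)|
        ≤ (3 * (2 : ℝ≥0∞) ^ ((k : ℝ) / 2)) * σ * (d t (p (k + 1)) + d t (p k)) := by
          refine (hz k hk).trans ?_
          gcongr
          · exact ofReal_sqrt_eight_mul_two_pow_le k
          · exact (hd k).trans (add_le_add (hρ _) (hρ _))
      _ = 3 * σ * ((2 : ℝ≥0∞) ^ ((k : ℝ) / 2) * d t (p (k + 1)) + b k) := by
          simp only [hb]; ring
      _ ≤ 3 * σ * (b (k + 1) + b k) := by
          simp only [hb]
          gcongr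
          · norm_num
          · linarith
  calc ENNReal.ofReal |z t - z (ρ K)|
      ≤ ∑ k ∈ Finset.Ico K N, ENNReal.ofReal |z (ρ (k + 1)) - z (ρ k)| := by
        rw [← hN]; exact ofReal_abs_sub_le_sum_Ico (fun k => z (ρ k)) hKN
    _ ≤ ∑ k ∈ Finset.Ico K N, 3 * σ * (b (k + 1) + b k) :=
        Finset.sum_le_sum fun k hk => hstep k (Finset.mem_Ico.1 hk).1
    _ ≤ ∑' k, 3 * σ * (b (k + 1) + b k) := ENNReal.sum_le_tsum _
    _ = 3 * σ * (∑' k, b (k + 1) + ∑' k, b k) := by rw [ENNReal.tsum_mul_left, ENNReal.tsum_add]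
    _ ≤ 3 * σ * (Γ + Γ) := by
        gcongr
        exact (ENNReal.tsum_comp_le_tsum_of_injective (add_left_injective 1) b).trans hΓ
    _ = 6 * σ * Γ := by ring

variable {Ω : Type*} [MeasurableSpace Ω] {μ : Measure Ω}

/-- Generic chaining down to the level `K` for a process whose increments are sub-Gaussian on an
event `V`, uniformly over a sequence of points of the index set. -/
lemma measure_chain_le {d : α → α → ℝ≥0∞} {T : Set α} {Z : α → Ω → ℝ} {V : Set Ω} {σ Γ : ℝ≥0∞}
    (hself : ∀ t ∈ T, d t t = 0)
    (htri : ∀ t ∈ T, ∀ r ∈ T, ∀ s ∈ T, d r s ≤ d t r + d t s)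
    (hinc : ∀ r ∈ T, ∀ s ∈ T, ∀ x : ℝ, 0 < x →
      μ (V ∩ {ω | ¬ ENNReal.ofReal |Z r ω - Z s ω| ≤ ENNReal.ofReal (Real.sqrt x) * σ * d r s}) ≤
        ENNReal.ofReal (2 * Real.exp (-x)))
    {A : ℕ → Finset α} {π : ℕ → α → α} (hAT : ∀ k, ↑(A k) ⊆ T)
    (hcard : ∀ k, (A k).card ≤ 2 ^ 2 ^ k)
    (hπ : ∀ t ∈ T, (∀ k, π k t ∈ A k) ∧
      ∑' k : ℕ, (2 : ℝ≥0∞) ^ ((k : ℝ) / 2) * d t (π k t) ≤ Γ)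
    {e : ℕ → α} (he : ∀ i, e i ∈ T) (K : ℕ) :
    μ (V ∩ {ω | ¬ ∀ i, ∃ s ∈ enumNet A e K, ENNReal.ofReal |Z (e i) ω - Z s ω| ≤ 6 * σ * Γ}) ≤
      ENNReal.ofReal (2 * Real.exp (-2 ^ K)) := by
  classical
  have hnetT : ∀ k, ∀ s ∈ enumNet A e k, s ∈ T := by
    intro k s hs
    rcases Finset.mem_union.1 hs with h | h
    · exact hAT k h
    · obtain ⟨i, -, rfl⟩ := Finset.mem_image.1 h
      exact he i
  set bad : ℕ → α × α → Set Ω := fun k q =>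
    V ∩ {ω | ¬ ENNReal.ofReal |Z q.1 ω - Z q.2 ω| ≤
      ENNReal.ofReal (Real.sqrt (8 * 2 ^ k)) * σ * d q.1 q.2} with hbad
  set net := enumNet A e with hnet
  have hsub : V ∩ {ω | ¬ ∀ i, ∃ s ∈ net K, ENNReal.ofReal |Z (e i) ω - Z s ω| ≤ 6 * σ * Γ} ⊆
      ⋃ k : ℕ, ⋃ q ∈ net (K + k + 1) ×ˢ net (K + k), bad (K + k) q := by
    rintro ω ⟨hV, hω⟩
    by_contra hgood
    refine hω fun i => ?_
    have hgood' : ∀ k, K ≤ k → ∀ r ∈ net (k + 1), ∀ s ∈ net k,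
        ENNReal.ofReal |Z r ω - Z s ω| ≤ ENNReal.ofReal (Real.sqrt (8 * 2 ^ k)) * σ * d r s := by
      intro k hk r hr s hs
      by_contra hneg
      obtain ⟨j, rfl⟩ := Nat.exists_eq_add_of_le hk
      exact hgood (Set.mem_iUnion.2 ⟨j, Set.mem_iUnion₂.2
        ⟨(r, s), Finset.mem_product.2 ⟨hr, hs⟩, hV, hneg⟩⟩)
    set ρ : ℕ → α := fun k => if i < k then e i else π k (e i) with hρ_def
    have hρ : ∀ k, ρ k ∈ net k := by
      intro k
      simp only [hρ_def]
      split_ifs with h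
      · exact Finset.mem_union_right _ (Finset.mem_image_of_mem e (Finset.mem_range.2 h))
      · exact Finset.mem_union_left _ ((hπ _ (he i)).1 k)
    refine ⟨ρ K, hρ K, ?_⟩
    refine ofReal_abs_sub_le_of_chain (z := fun t => Z t ω) (ρ := ρ) (p := fun k => π k (e i))
      (N := K + (i + 1)) (Nat.le_add_right _ _) ?_ (fun k => ?_) (fun k => ?_) (hπ _ (he i)).2
      (fun k hk => hgood' k hk _ (hρ _) _ (hρ k))
    · simp only [hρ_def]; rw [if_pos (by omega)]
    · exact htri _ (he i) _ (hnetT _ _ (hρ _)) _ (hnetT _ _ (hρ _))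
    · simp only [hρ_def]
      split_ifs with h
      · rw [hself _ (he i)]; exact zero_le
      · exact le_rfl
  -- A level has at most `exp (6 * 2 ^ k)` links, so that the deviation parameter `8 * 2 ^ k` leaves a
  -- summable remainder.
  have hlevel : ∀ k, μ (⋃ q ∈ net (k + 1) ×ˢ net k, bad k q) ≤
      ENNReal.ofReal (2 * Real.exp (-(2 * 2 ^ k))) := by
    intro k
    calc μ (⋃ q ∈ net (k + 1) ×ˢ net k, bad k q)
        ≤ ∑ q ∈ net (k + 1) ×ˢ net k, μ (bad k q) := measure_biUnion_finset_le _ _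
      _ ≤ ∑ q ∈ net (k + 1) ×ˢ net k, ENNReal.ofReal (2 * Real.exp (-(8 * 2 ^ k))) := by
          refine Finset.sum_le_sum fun q hq => ?_
          obtain ⟨h1, h2⟩ := Finset.mem_product.1 hq
          exact hinc _ (hnetT _ _ h1) _ (hnetT _ _ h2) _ (by positivity)
      _ = ENNReal.ofReal ((net (k + 1)).card * (net k).card *
            (2 * Real.exp (-(8 * 2 ^ k)))) := by
          rw [Finset.sum_const, Finset.card_product, nsmul_eq_mul, ← Nat.cast_mul,
            ENNReal.ofReal_mul (Nat.cast_nonneg _), ENNReal.ofReal_natCast]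
      _ ≤ ENNReal.ofReal (Real.exp (2 * 2 ^ (k + 1)) * Real.exp (2 * 2 ^ k) *
            (2 * Real.exp (-(8 * 2 ^ k)))) := by
          refine ENNReal.ofReal_le_ofReal ?_
          gcongr
          · exact card_enumNet_le hcard e (k + 1)
          · exact card_enumNet_le hcard e k
      _ = ENNReal.ofReal (2 * Real.exp (-(2 * 2 ^ k))) := by
          congr 1
          rw [mul_left_comm, ← Real.exp_add, ← Real.exp_add]
          congr 2
          ring
  calc μ (V ∩ {ω | ¬ ∀ i, ∃ s ∈ net K, ENNReal.ofReal |Z (e i) ω - Z s ω| ≤ 6 * σ * Γ})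
      ≤ ∑' k, μ (⋃ q ∈ net (K + k + 1) ×ˢ net (K + k), bad (K + k) q) :=
        (measure_mono hsub).trans (measure_iUnion_le _)
    _ ≤ ∑' k : ℕ, ENNReal.ofReal (2 * Real.exp (-2 ^ K)) * ENNReal.ofReal (Real.exp (-2 ^ k)) := by
        refine ENNReal.tsum_le_tsum fun k => (hlevel (K + k)).trans ?_
        rw [← ENNReal.ofReal_mul (by positivity), mul_assoc, ← Real.exp_add]
        refine ENNReal.ofReal_le_ofReal ?_
        have h1 : (2 : ℝ) ^ K ≤ 2 ^ (K + k) := pow_le_pow_right₀ (by norm_num) (by omega)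
        have h2 : (2 : ℝ) ^ k ≤ 2 ^ (K + k) := pow_le_pow_right₀ (by norm_num) (by omega)
        gcongr
        linarith
    _ ≤ ENNReal.ofReal (2 * Real.exp (-2 ^ K)) * 1 := by
        rw [ENNReal.tsum_mul_left]
        gcongr
        exact tsum_exp_neg_two_pow_le
    _ = _ := mul_one _

end Chaining

/-! ### The supremum of the multiplier process -/

section Supremum

variable {Ω B : Type*} [MeasurableSpace Ω] [MeasurableSpace B] {μ : Measure Ω}
  [IsProbabilityMeasure μ] {P : Measure B} {ξ : Ω → ℝ} {X : Ω → B} {n : ℕ} {ξs : Fin n → Ω → ℝ}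
  {Xs : Fin n → Ω → B}

omit [MeasurableSpace B] [IsProbabilityMeasure μ] in
/-- For a separable process it is enough to control a sequence of points that contains a prescribed
one. -/
lemma IsSeparableFamily.exists_seq {α : Type*} {Z : α → Ω → ℝ} {T : Set α}
    (h : IsSeparableFamily μ Z T) {t₀ : α} (ht₀ : t₀ ∈ T) :
    ∃ e : ℕ → α, (∀ i, e i ∈ T) ∧ ∀ᵐ ω ∂μ, ∀ R : ℝ≥0∞,
      (∀ i, ENNReal.ofReal |Z (e i) ω - Z t₀ ω| ≤ R) →
        ⨆ t ∈ T, ENNReal.ofReal |Z t ω - Z t₀ ω| ≤ R := by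
  obtain ⟨D, hDT, hD, hcl⟩ := h
  obtain ⟨e, he⟩ := (hD.insert t₀).exists_eq_range (Set.insert_nonempty _ _)
  refine ⟨e, fun i => ?_, ?_⟩
  · have : e i ∈ insert t₀ D := he ▸ Set.mem_range_self i
    exact Set.insert_subset ht₀ hDT this
  · filter_upwards [hcl] with ω hω R hR
    refine iSup₂_le fun t ht => ?_
    have hclosed : IsClosed {x : ℝ | ENNReal.ofReal |x - Z t₀ ω| ≤ R} :=
      isClosed_le (ENNReal.continuous_ofReal.comp (by fun_prop)) continuous_const
    refine closure_minimal ?_ hclosed (hω t ht)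
    rintro _ ⟨s, hs, rfl⟩
    obtain ⟨i, rfl⟩ : s ∈ Set.range e := he ▸ Set.mem_insert_of_mem _ hs
    exact hR i

/-- The coarsest step of the chain: a union bound over a finite set of functions. -/
lemma measure_exists_increment_gt_le (hS : IsIIDSample μ ξ X ξs Xs) (hP : μ.map X = P)
    (hn : 1 ≤ n) (hξ : HasPsi2Bound μ ξ (2 * (psi2Norm μ ξ).toReal)) (hξ' : psi2Norm μ ξ < ∞)
    {f₀ : B → ℝ} (hf₀ : f₀ ∈ LPsi2 P) {N : Finset (B → ℝ)} (hN : ∀ f ∈ N, f ∈ LPsi2 P) {x : ℝ}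
    (hx : 0 < x) (hcard : (N.card : ℝ) ≤ Real.exp (2 * x)) :
    μ {ω | ¬ ∀ f ∈ N, ENNReal.ofReal |multProc μ ξ X ξs Xs f ω - multProc μ ξ X ξs Xs f₀ ω| ≤
      ENNReal.ofReal (40 * (Real.sqrt (4 * x / n) + 4 * x / n)) * psi2Norm μ ξ *
        psi2Dist P f f₀} ≤ ENNReal.ofReal (2 * Real.exp (-x)) := by
  set bad : (B → ℝ) → Set Ω := fun f =>
    {ω | ¬ ENNReal.ofReal |multProc μ ξ X ξs Xs f ω - multProc μ ξ X ξs Xs f₀ ω| ≤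
      ENNReal.ofReal (40 * (Real.sqrt (4 * x / n) + 4 * x / n)) * psi2Norm μ ξ *
        psi2Dist P f f₀} with hbad
  have hone : ∀ f ∈ N, μ (bad f) ≤ ENNReal.ofReal (2 * Real.exp (-(4 * x))) := by
    intro f hf
    have := measure_increment_le_of_forall hS hP hξ hξ' (hN f hf) hf₀ Set.univ
      (r := 10 * (Real.sqrt (4 * x / n) + 4 * x / n)) (by positivity) fun b hb => by
        rw [Set.univ_inter]
        exact measure_multProc_gt_sqrt_add_le hS hn ((hN f hf).1.sub hf₀.1) hξ hb
          (t := 4 * x) (by positivity)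
    rw [Set.univ_inter, ← mul_assoc 4 10] at this
    norm_num only at this
    exact this
  calc μ _ ≤ μ (⋃ f ∈ N, bad f) := by
        refine measure_mono fun ω hω => ?_
        rw [Set.mem_ofPred_eq] at hω
        push Not at hω
        obtain ⟨f, hf, hlt⟩ := hω
        exact Set.mem_iUnion₂.2 ⟨f, hf, not_le.2 hlt⟩
    _ ≤ ∑ f ∈ N, μ (bad f) := measure_biUnion_finset_le _ _
    _ ≤ ∑ f ∈ N, ENNReal.ofReal (2 * Real.exp (-(4 * x))) := Finset.sum_le_sum hone
    _ = ENNReal.ofReal (N.card * (2 * Real.exp (-(4 * x)))) := by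
        rw [Finset.sum_const, nsmul_eq_mul, ENNReal.ofReal_mul (Nat.cast_nonneg _),
          ENNReal.ofReal_natCast]
    _ ≤ ENNReal.ofReal (2 * Real.exp (-x)) := by
        refine ENNReal.ofReal_le_ofReal ?_
        calc N.card * (2 * Real.exp (-(4 * x))) ≤ Real.exp (2 * x) * (2 * Real.exp (-(4 * x))) := by
              gcongr
          _ = 2 * Real.exp (-(2 * x)) := by
              rw [mul_left_comm, ← Real.exp_add]; congr 2; ring
          _ ≤ 2 * Real.exp (-x) := by gcongr; linarith

/-- The quantity `40 √v / √n ‖ξ‖` is the sub-Gaussian scale of the increments of the multiplier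
process. -/
lemma measure_multiplierEvent_inter_increment_gt_le (hS : IsIIDSample μ ξ X ξs Xs)
    (hP : μ.map X = P) (hn : 1 ≤ n) (hξ : HasPsi2Bound μ ξ (2 * (psi2Norm μ ξ).toReal))
    (hξ' : psi2Norm μ ξ < ∞) {f g : B → ℝ} (hf : f ∈ LPsi2 P) (hg : g ∈ LPsi2 P) {v x : ℝ}
    (hv : 1 ≤ v) (hx : 0 < x) :
    μ (multiplierEvent ξs (2 * (psi2Norm μ ξ).toReal) v ∩
      {ω | ¬ ENNReal.ofReal |multProc μ ξ X ξs Xs f ω - multProc μ ξ X ξs Xs g ω| ≤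
        ENNReal.ofReal (Real.sqrt x) *
          (ENNReal.ofReal (40 * Real.sqrt v / Real.sqrt n) * psi2Norm μ ξ) * psi2Dist P f g}) ≤
      ENNReal.ofReal (2 * Real.exp (-x)) := by
  have h := measure_increment_le_of_forall hS hP hξ hξ' hf hg
    (multiplierEvent ξs (2 * (psi2Norm μ ξ).toReal) v)
    (r := 10 * (Real.sqrt v * Real.sqrt (x / n))) (by positivity) fun b hb =>
      measure_multiplierEvent_inter_multProc_gt_le hS hn (hf.1.sub hg.1) hξ hb hx hv
  have e : 4 * (10 * (Real.sqrt v * Real.sqrt (x / n))) =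
      Real.sqrt x * (40 * Real.sqrt v / Real.sqrt n) := by
    rw [Real.sqrt_div hx.le]; ring
  rwa [e, ENNReal.ofReal_mul (Real.sqrt_nonneg _), mul_assoc (ENNReal.ofReal (Real.sqrt x))] at h

/-- Comparison of the numerical constants. The summand `Δ` added to `γ` contributes `√v / √n Δ`, which
`√(u v / n) Δ` absorbs. -/
lemma chain_bound_le {n : ℕ} (hn : 1 ≤ n) {u v x : ℝ} (hu : 1 ≤ u) (hv : 1 ≤ v) (hx : 0 < x)
    (hxu : x ≤ 2 * u) (a γ Δ : ℝ≥0∞) :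
    6 * (ENNReal.ofReal (40 * Real.sqrt v / Real.sqrt n) * a) * (γ + Δ) +
        ENNReal.ofReal (40 * (Real.sqrt (4 * x / n) + 4 * x / n)) * a * (Δ + Δ) ≤
      ENNReal.ofReal 640 * (ENNReal.ofReal (Real.sqrt v + 1) * a * (γ / ENNReal.ofReal (Real.sqrt n))
        + ENNReal.ofReal (Real.sqrt (2 * u / n) + u / n + Real.sqrt (u * v / n)) * a * Δ) := by
  have hn0 : (0 : ℝ) < n := by exact_mod_cast hn
  have hsn : 0 < Real.sqrt n := Real.sqrt_pos.2 hn0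
  have h1 : Real.sqrt (4 * x / n) ≤ 2 * Real.sqrt (2 * u / n) := by
    have : Real.sqrt (4 * x / n) ≤ Real.sqrt (2 ^ 2 * (2 * u / n)) := by
      refine Real.sqrt_le_sqrt ?_
      rw [← mul_div_assoc]
      gcongr
      linarith
    rwa [Real.sqrt_mul (by norm_num), Real.sqrt_sq (by norm_num)] at this
  have h2 : 4 * x / n ≤ 8 * (u / n) := by
    rw [← mul_div_assoc]
    exact div_le_div_of_nonneg_right (by linarith) hn0.le
  have h3 : Real.sqrt v / Real.sqrt n ≤ Real.sqrt (u * v / n) := by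
    rw [← Real.sqrt_div (by linarith)]
    refine Real.sqrt_le_sqrt ?_
    gcongr
    nlinarith
  have h4 : ENNReal.ofReal (240 * (Real.sqrt v / Real.sqrt n)) ≤
      ENNReal.ofReal (640 * (Real.sqrt v + 1)) / ENNReal.ofReal (Real.sqrt n) := by
    rw [← ENNReal.ofReal_div_of_pos hsn]
    refine ENNReal.ofReal_le_ofReal ?_
    rw [← mul_div_assoc]
    exact div_le_div_of_nonneg_right (by linarith [Real.sqrt_nonneg v]) hsn.le
  have h5 : ENNReal.ofReal (240 * (Real.sqrt v / Real.sqrt n) +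
      80 * (Real.sqrt (4 * x / n) + 4 * x / n)) ≤ ENNReal.ofReal (640 *
        (Real.sqrt (2 * u / n) + u / n + Real.sqrt (u * v / n))) := by
    refine ENNReal.ofReal_le_ofReal ?_
    have := Real.sqrt_nonneg (2 * u / n)
    have := Real.sqrt_nonneg (u * v / n)
    linarith
  have e1 : 6 * ENNReal.ofReal (40 * Real.sqrt v / Real.sqrt n) =
      ENNReal.ofReal (240 * (Real.sqrt v / Real.sqrt n)) := by
    rw [show (6 : ℝ≥0∞) = ENNReal.ofReal 6 by norm_num, ← ENNReal.ofReal_mul (by norm_num)]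
    congr 1; ring
  have e2 : 2 * ENNReal.ofReal (40 * (Real.sqrt (4 * x / n) + 4 * x / n)) =
      ENNReal.ofReal (80 * (Real.sqrt (4 * x / n) + 4 * x / n)) := by
    rw [show (2 : ℝ≥0∞) = ENNReal.ofReal 2 by norm_num, ← ENNReal.ofReal_mul (by norm_num)]
    congr 1; ring
  calc 6 * (ENNReal.ofReal (40 * Real.sqrt v / Real.sqrt n) * a) * (γ + Δ) +
        ENNReal.ofReal (40 * (Real.sqrt (4 * x / n) + 4 * x / n)) * a * (Δ + Δ)
      = (6 * ENNReal.ofReal (40 * Real.sqrt v / Real.sqrt n)) * a * γ +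
        (6 * ENNReal.ofReal (40 * Real.sqrt v / Real.sqrt n) +
          2 * ENNReal.ofReal (40 * (Real.sqrt (4 * x / n) + 4 * x / n))) * a * Δ := by ring
    _ ≤ (ENNReal.ofReal (640 * (Real.sqrt v + 1)) / ENNReal.ofReal (Real.sqrt n)) * a * γ +
        ENNReal.ofReal (640 * (Real.sqrt (2 * u / n) + u / n + Real.sqrt (u * v / n))) * a * Δ := by
        rw [e1, e2, ← ENNReal.ofReal_add (by positivity) (by positivity)]
        gcongr
    _ = _ := by
        rw [ENNReal.ofReal_mul (by norm_num : (0 : ℝ) ≤ 640),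
          ENNReal.ofReal_mul (by norm_num : (0 : ℝ) ≤ 640)]
        simp only [div_eq_mul_inv]
        ring

end Supremum

theorem theorem4 :
    ∃ c C : ℝ, 0 < c ∧ 0 < C ∧
      ∀ {Ω B : Type*} [MeasurableSpace Ω] [MeasurableSpace B]
        (μ : Measure Ω) [IsProbabilityMeasure μ] (P : Measure B) [IsProbabilityMeasure P]
        (ξ : Ω → ℝ) (X : Ω → B) (_ : Measurable ξ) (_ : Measurable X) (_ : μ.map X = P)
        (_ : psi2Norm μ ξ < ∞)
        (n : ℕ) (_ : 1 ≤ n) (ξs : Fin n → Ω → ℝ) (Xs : Fin n → Ω → B)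
        (_ : ∀ i, IdentDistrib (fun ω => (ξs i ω, Xs i ω)) (fun ω => (ξ ω, X ω)) μ μ)
        (_ : iIndepFun (fun i ω => (ξs i ω, Xs i ω)) μ)
        (F : Set (B → ℝ)) (_ : F ⊆ LPsi2 P)
        (_ : IsSeparableFamily μ (multProc μ ξ X ξs Xs) F)
        (f₀ : B → ℝ) (_ : f₀ ∈ F) (u v : ℝ) (_ : 1 ≤ u) (_ : 1 ≤ v),
        μ {ω | ¬ (⨆ f ∈ F, ENNReal.ofReal
              |multProc μ ξ X ξs Xs f ω - multProc μ ξ X ξs Xs f₀ ω|) ≤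
            ENNReal.ofReal C *
              (ENNReal.ofReal (Real.sqrt v + 1) * psi2Norm μ ξ *
                  (gammaTwo (psi2Dist P) F / ENNReal.ofReal (Real.sqrt n)) +
                ENNReal.ofReal (Real.sqrt (2 * u / n) + u / n + Real.sqrt (u * v / n)) *
                  psi2Norm μ ξ * psi2Radius P F)} ≤
          ENNReal.ofReal (c * Real.exp (-u / 4) + c * Real.exp (-(n * v))) := by
  refine ⟨4, 640, by norm_num, by norm_num, ?_⟩
  intro Ω B _ _ μ _ P _ ξ X hξm hXm hP hξ' n hn ξs Xs hid hind F hF hsep f₀ hf₀ u v hu hv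
  have hS : IsIIDSample μ ξ X ξs Xs := ⟨hξm, hXm, hid, hind⟩
  have hn0 : (0 : ℝ) < n := by exact_mod_cast hn
  have hsn : 0 < Real.sqrt n := Real.sqrt_pos.2 hn0
  rcases eq_or_ne (psi2Norm μ ξ) 0 with hξ0 | hξ0
  · have h0 := multProc_ae_eq_zero_of_left hS (ae_eq_zero_of_psi2Norm_eq_zero hξm hξ0)
    refine le_of_eq_of_le ?_ zero_le
    rw [← ae_iff]
    filter_upwards [h0] with ω hω
    simp [hω]
  have hv0 : 0 < Real.sqrt v + 1 := by positivity
  have hu0 : 0 < Real.sqrt (2 * u / n) + u / n + Real.sqrt (u * v / n) := by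
    have : 0 < u / n := by positivity
    positivity
  rcases eq_or_ne (gammaTwo (psi2Dist P) F) ∞ with hγ | hγ
  · refine le_of_eq_of_le ?_ zero_le
    have htop : ENNReal.ofReal (Real.sqrt v + 1) * psi2Norm μ ξ *
        (gammaTwo (psi2Dist P) F / ENNReal.ofReal (Real.sqrt n)) = ∞ := by
      rw [hγ, ENNReal.top_div_of_ne_top ENNReal.ofReal_ne_top]
      exact ENNReal.mul_top (mul_ne_zero (ENNReal.ofReal_pos.2 hv0).ne' hξ0)
    simp [htop, ENNReal.mul_top]
  set α := (psi2Norm μ ξ).toReal with hα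
  have hα0 : 0 < α := ENNReal.toReal_pos hξ0 hξ'.ne
  have hξ : HasPsi2Bound μ ξ (2 * α) := by
    refine hasPsi2Bound_of_lt hξm ?_
    rw [← ENNReal.ofReal_toReal hξ'.ne]
    exact (ENNReal.ofReal_lt_ofReal_iff (by positivity)).2 (by linarith)
  have hrad : ∀ f ∈ F, psi2Dist P f (fun _ => 0) ≤ psi2Radius P F := fun f hf =>
    le_iSup₂ (f := fun f (_ : f ∈ F) => psi2Dist P f (fun _ => 0)) f hf
  have hdiam : ∀ f ∈ F, psi2Dist P f f₀ ≤ psi2Radius P F + psi2Radius P F := by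
    intro f hf
    refine (psi2Dist_triangle (hF hf).1 measurable_const).trans (add_le_add (hrad f hf) ?_)
    rw [psi2Dist_comm]
    exact hrad f₀ hf₀
  obtain ⟨A, π, hAF, hcard, hπ⟩ := exists_finset_nets (d := psi2Dist P) hf₀
    (δ := psi2Radius P F) (fun h0 f hf => by simpa [h0] using hdiam f hf)
    (lt_top_iff_ne_top.2 hγ)
  obtain ⟨e, heF, hsup⟩ := hsep.exists_seq hf₀
  -- The chain starts at the first level `K` at which `2 ^ K` exceeds `u`.
  obtain ⟨j, hj₁, hj₂⟩ := exists_nat_pow_near hu (one_lt_two : (1 : ℝ) < 2)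
  set K := j + 1 with hK
  have hKu : (2 : ℝ) ^ K ≤ 2 * u := by rw [hK, pow_succ]; linarith
  have hnetF : ∀ f ∈ enumNet A e K, f ∈ F := by
    classical
    intro f hf
    rcases Finset.mem_union.1 hf with h | h
    · exact hAF K h
    · obtain ⟨i, -, rfl⟩ := Finset.mem_image.1 h
      exact heF i
  set V := multiplierEvent ξs (2 * α) v
  set σ := ENNReal.ofReal (40 * Real.sqrt v / Real.sqrt n) * psi2Norm μ ξ with hσ
  set Γ := gammaTwo (psi2Dist P) F + psi2Radius P F with hΓ
  set Z := multProc μ ξ X ξs Xs with hZ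
  have hchain := measure_chain_le (μ := μ) (d := psi2Dist P) (T := F) (Z := Z) (V := V)
    (σ := σ) (Γ := Γ) (fun f _ => psi2Dist_self f)
    (fun f hf g hg h _ => by
      rw [psi2Dist_comm f g]; exact psi2Dist_triangle (hF hg).1 (hF hf).1)
    (fun f hf g hg x hx =>
      measure_multiplierEvent_inter_increment_gt_le hS hP hn hξ hξ' (hF hf) (hF hg) hv hx)
    hAF hcard hπ heF K
  have hfirst := measure_exists_increment_gt_le hS hP hn hξ hξ' (hF hf₀)
    (fun f hf => hF (hnetF f hf)) (by positivity : (0 : ℝ) < 2 ^ K) (card_enumNet_le hcard e K)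
  have hV : μ Vᶜ ≤ ENNReal.ofReal (Real.exp (-(n * v))) :=
    measure_compl_multiplierEvent_le hS hξ hv
  have hle := chain_bound_le hn hu hv (by positivity : (0 : ℝ) < 2 ^ K) hKu (psi2Norm μ ξ)
    (gammaTwo (psi2Dist P) F) (psi2Radius P F)
  set R := ENNReal.ofReal 640 * (ENNReal.ofReal (Real.sqrt v + 1) * psi2Norm μ ξ *
      (gammaTwo (psi2Dist P) F / ENNReal.ofReal (Real.sqrt n)) +
    ENNReal.ofReal (Real.sqrt (2 * u / n) + u / n + Real.sqrt (u * v / n)) *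
      psi2Norm μ ξ * psi2Radius P F)
  set E₁ := V ∩ {ω | ¬ ∀ i, ∃ s ∈ enumNet A e K,
    ENNReal.ofReal |Z (e i) ω - Z s ω| ≤ 6 * σ * Γ} with hE₁
  set E₂ := {ω | ¬ ∀ f ∈ enumNet A e K, ENNReal.ofReal |Z f ω - Z f₀ ω| ≤
      ENNReal.ofReal (40 * (Real.sqrt (4 * 2 ^ K / n) + 4 * 2 ^ K / n)) * psi2Norm μ ξ *
        psi2Dist P f f₀} with hE₂
  have hsub : {ω | ¬ (⨆ f ∈ F, ENNReal.ofReal |Z f ω - Z f₀ ω|) ≤ R} ≤ᵐ[μ]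
      ((Vᶜ ∪ E₁) ∪ E₂ : Set Ω) := by
    filter_upwards [hsup] with ω hω hbad
    by_contra hgood
    have hgood' : ω ∉ (Vᶜ ∪ E₁) ∪ E₂ := hgood
    simp only [Set.mem_union, not_or, Set.mem_compl_iff, not_not] at hgood'
    obtain ⟨⟨hωV, hω₁⟩, hω₂⟩ := hgood'
    have h₁ : ∀ i, ∃ s ∈ enumNet A e K, ENNReal.ofReal |Z (e i) ω - Z s ω| ≤ 6 * σ * Γ := by
      by_contra h; exact hω₁ ⟨hωV, h⟩
    have h₂ := not_not.1 hω₂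
    refine hbad (hω R fun i => ?_)
    obtain ⟨s, hs, hs'⟩ := h₁ i
    calc ENNReal.ofReal |Z (e i) ω - Z f₀ ω|
        ≤ ENNReal.ofReal (|Z (e i) ω - Z s ω| + |Z s ω - Z f₀ ω|) :=
          ENNReal.ofReal_le_ofReal (abs_sub_le _ _ _)
      _ = ENNReal.ofReal |Z (e i) ω - Z s ω| + ENNReal.ofReal |Z s ω - Z f₀ ω| :=
          ENNReal.ofReal_add (abs_nonneg _) (abs_nonneg _)
      _ ≤ 6 * σ * Γ + ENNReal.ofReal (40 * (Real.sqrt (4 * 2 ^ K / n) + 4 * 2 ^ K / n)) *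
            psi2Norm μ ξ * (psi2Radius P F + psi2Radius P F) := by
          refine add_le_add hs' ((h₂ s hs).trans ?_)
          gcongr
          exact hdiam s (hnetF s hs)
      _ ≤ R := hle
  calc μ {ω | ¬ (⨆ f ∈ F, ENNReal.ofReal |Z f ω - Z f₀ ω|) ≤ R}
      ≤ μ ((Vᶜ ∪ E₁) ∪ E₂) := measure_mono_ae hsub
    _ ≤ (μ Vᶜ + μ E₁) + μ E₂ :=
        (measure_union_le _ _).trans (add_le_add_left (measure_union_le _ _) _)
    _ ≤ (ENNReal.ofReal (Real.exp (-(n * v))) + ENNReal.ofReal (2 * Real.exp (-2 ^ K))) +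
          ENNReal.ofReal (2 * Real.exp (-2 ^ K)) := by gcongr
    _ = ENNReal.ofReal (Real.exp (-(n * v)) + 2 * Real.exp (-2 ^ K) + 2 * Real.exp (-2 ^ K)) := by
        rw [← ENNReal.ofReal_add (by positivity) (by positivity),
          ← ENNReal.ofReal_add (by positivity) (by positivity)]
    _ ≤ ENNReal.ofReal (4 * Real.exp (-u / 4) + 4 * Real.exp (-(n * v))) := by
        refine ENNReal.ofReal_le_ofReal ?_
        have h1 : Real.exp (-2 ^ K) ≤ Real.exp (-u / 4) := Real.exp_le_exp.2 (by linarith)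
        have h2 := Real.exp_pos (-(n * v))
        linarith
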